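/- Let $\alpha>0$ and $\beta\in(0,\tfrac12)$. In the linear win/tie/loss model, a game played at strength differential $s$ gives $1$ point with probability $W(s)=\alpha s+\beta$, $\tfrac12$ point with probability $T(s)=1-2\beta$, and $0$ points with probability $L(s)=-\alpha s+\beta$. Team $A$ has players of strengths $a_1\ge\cdots\ge a_n$ and team $B$ has players of strengths $b_1\ge\cdots\ge b_n$, where all differentials $b_j-a_i$ lie in $\left(-\tfrac{\beta}{\alpha},\tfrac{\beta}{\alpha}\right)\cap\left(\tfrac{\beta-1}{\alpha},\tfrac{1-\beta}{\alpha}\right)$. For an ordering (permutation) $\sigma$ of $\{1,\dots,n\}$, let $X_\sigma=\sum_{i=1}^n X_{\sigma(i),i}$ be the total number of points earned by team $B$ in $n$ independent games, where in game $i$ player $\sigma(i)$ of team $B$ faces player $i$ of team $A$, at strength differential $b_{\sigma(i)}-a_i$. The expectation $\mathbb E[X_\sigma]$ does not depend on $\sigma$; denote it by $\mu$. Let $k\in\tfrac12\mathbb Z$. 1. If $k\ge\mu+2.5$, then $\mathbb P(X_\sigma\ge k)$ is maximized, over all orderings $\sigma$, by $\sigma=(1,2,\dots,n)$ (strong-vs-strong).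 2. If $k\le\mu-2$, then $\mathbb P(X_\sigma\ge k)$ is maximized, over all orderings $\sigma$, by $\sigma=(n,n-1,\dots,1)$ (strong-vs-weak). 3. For $k\in(\mu-2,\mu+2.5)$, the optimal ordering may depend on how the teams are chosen: for every $\alpha>0$ and $\beta\in(0,\tfrac12)$ there are $n$, a threshold $k\in\tfrac12\mathbb Z$, and two pairs of teams $(A,B)$ and $(A',B')$ of $n$ players each, as above, with expected scores $\mu$ and $\mu'$, such that $k\in(\mu-2,\mu+2.5)\cap(\mu'-2,\mu'+2.5)$ and no ordering maximizes the probability of scoring at least $k$ both for $(A,B)$ and for $(A',B')$. -/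

import Mathlib

open MeasureTheory

namespace LinearMatch

/-- Probability of a win at strength differential `s` in the linear model. -/
def winProb (α β s : ℝ) : ℝ := α * s + β

/-- Probability of a loss at strength differential `s` in the linear model. -/
def lossProb (α β s : ℝ) : ℝ := -α * s + β

/-- Probability of a tie at strength differential `s` in the linear model (constant in `s`). -/
def tieProb (_α β _s : ℝ) : ℝ := 1 - 2 * β

/-- Law of the points earned in one game at strength differential `s`:
`1` for a win, `1/2` for a tie, `0` for a loss. -/
noncomputable def gameLaw (α β s : ℝ) : Measure ℝ :=
  ENNReal.ofReal (winProb α β s) • Measure.dirac 1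
    + ENNReal.ofReal (tieProb α β s) • Measure.dirac (1 / 2)
    + ENNReal.ofReal (lossProb α β s) • Measure.dirac 0

/-- Two teams of `n` players, each listed by weakly decreasing strength, such that all
strength differentials lie in the domain on which the linear model is assumed. -/
structure Admissible {n : ℕ} (α β : ℝ) (a b : Fin n → ℝ) : Prop where
  antitone_left : Antitone a
  antitone_right : Antitone b
  mem_domain : ∀ i j : Fin n, b j - a i ∈
    Set.Ioo (-(β / α)) (β / α) ∩ Set.Ioo ((β - 1) / α) ((1 - β) / α)

/-- Joint law of the points `(X_{σ(i),i})_i` earned by team `B` in the `n` independent games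
under the ordering `σ`: in game `i`, player `σ i` of team `B` faces player `i` of team `A`. -/
noncomputable def seriesLaw {n : ℕ} (α β : ℝ) (a b : Fin n → ℝ)
    (σ : Equiv.Perm (Fin n)) : Measure (Fin n → ℝ) :=
  Measure.pi fun i => gameLaw α β (b (σ i) - a i)

/-- The probability `P(X_σ ≥ k)`, where `X_σ` is the total of the points earned by team `B`. -/
noncomputable def tailProb {n : ℕ} (α β : ℝ) (a b : Fin n → ℝ)
    (σ : Equiv.Perm (Fin n)) (k : ℝ) : ℝ :=
  (seriesLaw α β a b σ).real {x | k ≤ ∑ i, x i}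

/-- The expectation `E[X_σ]`. -/
noncomputable def expectedScore {n : ℕ} (α β : ℝ) (a b : Fin n → ℝ)
    (σ : Equiv.Perm (Fin n)) : ℝ :=
  ∫ x, ∑ i, x i ∂(seriesLaw α β a b σ)

/-- The expected total score `μ`, computed at the identity ordering; by
`expectedScore_eq_meanScore` it is the same for every ordering. -/
noncomputable def meanScore {n : ℕ} (α β : ℝ) (a b : Fin n → ℝ) : ℝ :=
  expectedScore α β a b 1

/-- The ordering `σ` maximizes `P(X_σ ≥ k)` among all orderings. -/
def IsOptimal {n : ℕ} (α β : ℝ) (a b : Fin n → ℝ) (k : ℝ)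
    (σ : Equiv.Perm (Fin n)) : Prop :=
  ∀ τ : Equiv.Perm (Fin n), tailProb α β a b τ k ≤ tailProb α β a b σ k

/-- `k` is a possible score threshold, that is, `k ∈ ½ℤ`. -/
def IsHalfIntegral (k : ℝ) : Prop := ∃ m : ℤ, k = m / 2

theorem isProbabilityMeasure_gameLaw {α β s : ℝ} (hw : 0 ≤ winProb α β s)
    (ht : 0 ≤ tieProb α β s) (hl : 0 ≤ lossProb α β s) :
    IsProbabilityMeasure (gameLaw α β s) := by
  constructor
  simp only [gameLaw, Measure.add_apply, Measure.smul_apply, smul_eq_mul,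
    measure_univ, mul_one]
  rw [← ENNReal.ofReal_add hw ht, ← ENNReal.ofReal_add (by linarith) hl,
    ENNReal.ofReal_eq_one]
  simp only [winProb, tieProb, lossProb]
  ring

theorem integrable_gameLaw (α β s : ℝ) (f : ℝ → ℝ) : Integrable f (gameLaw α β s) := by
  have h (c x : ℝ) : Integrable f (ENNReal.ofReal c • Measure.dirac x) :=
    (integrable_dirac (by simp)).smul_measure (by simp)
  exact ((h _ _).add_measure (h _ _)).add_measure (h _ _)

theorem integral_gameLaw {α β s : ℝ} (hw : 0 ≤ winProb α β s)
    (ht : 0 ≤ tieProb α β s) : ∫ x, x ∂(gameLaw α β s) = α * s + 1 / 2 := by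
  have h (c x : ℝ) : Integrable (fun y : ℝ => y) (ENNReal.ofReal c • Measure.dirac x) :=
    (integrable_dirac (by simp)).smul_measure (by simp)
  rw [gameLaw, integral_add_measure ((h _ _).add_measure (h _ _)) (h _ _),
    integral_add_measure (h _ _) (h _ _)]
  simp only [integral_smul_measure, integral_dirac, ENNReal.toReal_ofReal hw,
    ENNReal.toReal_ofReal ht, smul_eq_mul]
  simp only [winProb, tieProb]
  ring

theorem Admissible.probs_pos {n : ℕ} {α β : ℝ} {a b : Fin n → ℝ} (hα : 0 < α)
    (h : Admissible α β a b) (i j : Fin n) :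
    0 < winProb α β (b j - a i) ∧ 0 < lossProb α β (b j - a i) := by
  obtain ⟨⟨h1, h2⟩, -⟩ := h.mem_domain i j
  rw [lt_div_iff₀ hα] at h2
  rw [← neg_div, div_lt_iff₀ hα] at h1
  constructor <;> simp only [winProb, lossProb] <;> nlinarith

theorem expectedScore_eq {n : ℕ} {α β : ℝ} {a b : Fin n → ℝ} (hα : 0 < α)
    (hβ : β ≤ 1 / 2) (h : Admissible α β a b) (σ : Equiv.Perm (Fin n)) :
    expectedScore α β a b σ = n / 2 + α * ∑ i, b i - α * ∑ i, a i := by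
  have ht (s : ℝ) : 0 ≤ tieProb α β s := by simp only [tieProb]; linarith
  have hp (i : Fin n) : IsProbabilityMeasure (gameLaw α β (b (σ i) - a i)) :=
    isProbabilityMeasure_gameLaw (h.probs_pos hα i (σ i)).1.le (ht _)
      (h.probs_pos hα i (σ i)).2.le
  rw [expectedScore, seriesLaw, integral_finsetSum]
  · have e (i : Fin n) : ∫ x : Fin n → ℝ, x i
        ∂(Measure.pi fun i => gameLaw α β (b (σ i) - a i)) =
        α * (b (σ i) - a i) + 1 / 2 := by
      rw [← integral_gameLaw (h.probs_pos hα i (σ i)).1.le (ht _)]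
      exact integral_comp_eval (μ := fun i => gameLaw α β (b (σ i) - a i))
        (f := fun y : ℝ => y) (by fun_prop)
    simp only [e, Finset.sum_add_distrib, ← Finset.mul_sum, Finset.sum_sub_distrib]
    rw [Equiv.sum_comp σ b]
    simp
    ring
  · intro i _
    exact integrable_comp_eval (μ := fun i => gameLaw α β (b (σ i) - a i))
      (f := fun y : ℝ => y) (integrable_gameLaw _ _ _ _)

theorem expectedScore_eq_meanScore {n : ℕ} {α β : ℝ} {a b : Fin n → ℝ} (hα : 0 < α)
    (hβ : β ≤ 1 / 2) (h : Admissible α β a b) (σ : Equiv.Perm (Fin n)) :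
    expectedScore α β a b σ = meanScore α β a b := by
  rw [meanScore, expectedScore_eq hα hβ h, expectedScore_eq hα hβ h]

end LinearMatch

/-!
In half-points, a game with `d = α * s` has generating polynomial
`f_d = (β - d) + (1 - 2β) X + (β + d) X²`, which is affine in `d` with slope `X² - 1`. Exchanging
the opponents of two players leaves the sum of the two values of `d` unchanged, so the product of
the two game polynomials changes by a multiple of `(X² - 1)²`. Hence the tail probability at `K`
half-points changes by
`α² (a i - a j) (b (σ j) - b (σ i)) (A (K - 3) - A (K - 1))`, where `A` is the coefficient sequence
of `(1 + X) R` and `R` is the product of the other game polynomials (`tailProb_mul_swap_sub`).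
Everything is thus a matter of the sign of a two-step difference of `A`.

This sequence need not be log-concave, as the `f_d` may have complex roots. However, all roots of
`(1 + X) R` have negative real part, and the ensuing minor inequalities
`A (k - 1) * A (k + 2) ≤ A k * A (k + 1)` (total positivity of the Hurwitz matrix) say that the
ratios `A (k + 2) / A k` decrease, so that the two-step differences change sign only once. These
inequalities are proved directly: they are preserved under multiplication by quadratics with
positive coefficients (`TwoStepConcave.quadratic_mul`). The sign change is located as in Darroch's
theorem on the mode of a sum of Bernoulli variables: with `H` the coefficient sequence of
`(1 + X)² R` and `M` the mean of `R`, the number `(k - M) * H k` is, up to the contribution of the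
two factors `1 + X`, a nonnegative combination of two-step differences with one game omitted
(`sub_mean_mul_intCoeff`). This gives the sign for `k` above `M + 2` and below `M`
(`intCoeff_add_two_le`, `intCoeff_sub_three_le`). Sorting by exchanges then yields the two optimal
orderings.

For the dependence on the teams near the mean, let each team have one leader and `m + 1` equal
players, so that an ordering matters only through whether the leaders meet. All games not involving
the leaders have the same `d = x`, and the decisive difference `A (m - 1) - A (m + 1)` is negative
for `x` near `β` and positive for `x` near `-β`, when `m` is the integer part of `1 / (2β)`.
-/

namespace LinearMatch
open Polynomial

/-! ### Coefficients and game polynomials -/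

/-- The coefficients of a polynomial as a sequence indexed by `ℤ`, zero at negative indices. -/
noncomputable def intCoeff (k : ℤ) : ℝ[X] →ₗ[ℝ] ℝ :=
  if 0 ≤ k then lcoeff ℝ k.toNat else 0

theorem intCoeff_natCast (n : ℕ) (P : ℝ[X]) : intCoeff n P = P.coeff n := by
  simp [intCoeff]

theorem intCoeff_of_neg {k : ℤ} (hk : k < 0) (P : ℝ[X]) : intCoeff k P = 0 := by
  simp [intCoeff, not_le.mpr hk]

theorem intCoeff_C_mul (k : ℤ) (r : ℝ) (P : ℝ[X]) :
    intCoeff k (C r * P) = r * intCoeff k P := by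
  rw [← smul_eq_C_mul, map_smul, smul_eq_mul]

theorem intCoeff_X_mul (k : ℤ) (P : ℝ[X]) : intCoeff k (X * P) = intCoeff (k - 1) P := by
  rcases lt_trichotomy k 0 with h | rfl | h
  · rw [intCoeff_of_neg h, intCoeff_of_neg (by omega)]
  · rw [intCoeff_of_neg (by decide : (0 : ℤ) - 1 < 0), ← Nat.cast_zero, intCoeff_natCast,
      coeff_X_mul_zero]
  · obtain ⟨n, rfl⟩ : ∃ n : ℕ, k = (n + 1 : ℕ) := ⟨k.toNat - 1, by omega⟩
    rw [intCoeff_natCast, coeff_X_mul, ← intCoeff_natCast]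
    congr 2
    push_cast
    ring

theorem intCoeff_X_sq_mul (k : ℤ) (P : ℝ[X]) : intCoeff k (X ^ 2 * P) = intCoeff (k - 2) P := by
  rw [pow_two, mul_assoc, intCoeff_X_mul, intCoeff_X_mul]
  congr 2
  ring

theorem intCoeff_X_mul_derivative (k : ℤ) (P : ℝ[X]) :
    intCoeff k (X * derivative P) = k * intCoeff k P := by
  rcases lt_or_ge k 0 with h | h
  · rw [intCoeff_of_neg h, intCoeff_of_neg h, mul_zero]
  · lift k to ℕ using h
    rw [intCoeff_natCast, intCoeff_natCast]
    cases k with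
    | zero => simp
    | succ n => rw [coeff_X_mul, coeff_derivative]; push_cast; ring

/-- The generating polynomial, in half-points, of one game with `d = α * s`:
a loss counts `X ^ 0`, a tie `X ^ 1` and a win `X ^ 2`. -/
noncomputable def gamePoly (β d : ℝ) : ℝ[X] :=
  C (β - d) + C (1 - 2 * β) * X + C (β + d) * X ^ 2

theorem intCoeff_gamePoly_mul (β d : ℝ) (k : ℤ) (P : ℝ[X]) :
    intCoeff k (gamePoly β d * P) = (β - d) * intCoeff k P +
      (1 - 2 * β) * intCoeff (k - 1) P + (β + d) * intCoeff (k - 2) P := by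
  rw [gamePoly, add_mul, add_mul, mul_assoc, mul_assoc, map_add, map_add, intCoeff_C_mul,
    intCoeff_C_mul, intCoeff_C_mul, intCoeff_X_mul, intCoeff_X_sq_mul]

/-! ### Sequences with decreasing two-step ratios -/

/-- A sequence on `ℤ`, positive exactly on the interval `[0, N]`, whose two-step ratios
`A (k + 2) / A k` are weakly decreasing there. The inequality is the nonnegativity of the
consecutive `2 × 2` minors of the Hurwitz matrix of the polynomial with coefficients `A`. -/
structure TwoStepConcave (N : ℤ) (A : ℤ → ℝ) : Prop where
  pos : ∀ k, 0 ≤ k → k ≤ N → 0 < A k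
  eq_zero : ∀ k, k < 0 ∨ N < k → A k = 0
  mul_le : ∀ k, A (k - 1) * A (k + 2) ≤ A k * A (k + 1)

namespace TwoStepConcave

variable {N : ℤ} {A : ℤ → ℝ}

theorem nonneg (h : TwoStepConcave N A) (k : ℤ) : 0 ≤ A k := by
  by_cases hk : 0 ≤ k ∧ k ≤ N
  · exact (h.pos k hk.1 hk.2).le
  · exact (h.eq_zero k (by omega)).ge

/-- The support has no internal zeros. -/
theorem pos_of_between (h : TwoStepConcave N A) {i j k : ℤ} (hik : i ≤ k) (hkj : k ≤ j)
    (hi : A i ≠ 0) (hj : A j ≠ 0) : 0 < A k := by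
  have h1 := mt (h.eq_zero i) hi
  have h2 := mt (h.eq_zero j) hj
  exact h.pos k (by omega) (by omega)

theorem mul_le_sq (h : TwoStepConcave N A) (k : ℤ) : A (k - 2) * A (k + 2) ≤ A k * A k := by
  by_cases h0 : A (k - 2) = 0 ∨ A (k + 2) = 0
  · rcases h0 with h0 | h0 <;> rw [h0] <;> nlinarith [mul_self_nonneg (A k)]
  · push Not at h0
    have p1 : 0 < A (k - 1) := h.pos_of_between (by omega) (by omega) h0.1 h0.2
    have p2 : 0 < A (k + 1) := h.pos_of_between (by omega) (by omega) h0.1 h0.2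
    have e1 := h.mul_le k
    have e2 := h.mul_le (k - 1)
    rw [show k - 1 - 1 = k - 2 by ring, show k - 1 + 2 = k + 1 by ring,
      show k - 1 + 1 = k by ring] at e2
    have e := mul_le_mul e1 e2 (mul_nonneg (h.nonneg _) (h.nonneg _))
      (mul_nonneg (h.nonneg _) (h.nonneg _))
    refine le_of_mul_le_mul_right ?_ (mul_pos p1 p2)
    linarith

theorem mul_le_mul_three (h : TwoStepConcave N A) (k : ℤ) :
    A (k - 3) * A (k + 2) ≤ A (k - 2) * A (k + 1) := by
  by_cases h0 : A (k - 3) = 0 ∨ A (k + 2) = 0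
  · have := mul_nonneg (h.nonneg (k - 2)) (h.nonneg (k + 1))
    rcases h0 with h0 | h0 <;> rw [h0] <;> linarith
  · push Not at h0
    have p1 : 0 < A (k - 1) := h.pos_of_between (by omega) (by omega) h0.1 h0.2
    have p2 : 0 < A k := h.pos_of_between (by omega) (by omega) h0.1 h0.2
    have e1 := h.mul_le k
    have e2 := h.mul_le (k - 2)
    rw [show k - 2 - 1 = k - 3 by ring, show k - 2 + 2 = k by ring,
      show k - 2 + 1 = k - 1 by ring] at e2
    have e := mul_le_mul e1 e2 (mul_nonneg (h.nonneg _) (h.nonneg _))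
      (mul_nonneg (h.nonneg _) (h.nonneg _))
    refine le_of_mul_le_mul_right ?_ (mul_pos p1 p2)
    linarith

/-- Once a two-step difference is negative, the next one is nonpositive. -/
theorem le_succ_of_lt (h : TwoStepConcave N A) {k : ℤ} (hk : A (k + 2) < A k) :
    A (k + 3) ≤ A (k + 1) := by
  have e := h.mul_le (k + 1)
  rw [show k + 1 - 1 = k by ring, show k + 1 + 2 = k + 3 by ring,
    show k + 1 + 1 = k + 2 by ring] at e
  have hp : 0 < A k := (h.nonneg _).trans_lt hk
  refine le_of_mul_le_mul_left (e.trans ?_) hp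
  rw [mul_comm (A k)]
  exact mul_le_mul_of_nonneg_left hk.le (h.nonneg _)

/-- Before a positive two-step difference, the differences are nonnegative. -/
theorem le_pred_of_lt (h : TwoStepConcave N A) {k : ℤ} (hk : A (k - 2) < A k) :
    A (k - 3) ≤ A (k - 1) := by
  have e := h.mul_le (k - 2)
  rw [show k - 2 - 1 = k - 3 by ring, show k - 2 + 2 = k by ring,
    show k - 2 + 1 = k - 1 by ring] at e
  have hp : 0 < A k := (h.nonneg _).trans_lt hk
  refine le_of_mul_le_mul_right (e.trans ?_) hp
  rw [mul_comm]
  exact mul_le_mul_of_nonneg_left hk.le (h.nonneg _)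

/-- Two-step differences that are nonpositive at `k` stay so. -/
theorem le_succ_of_le (h : TwoStepConcave N A) {k : ℤ} (h0 : 0 ≤ k) (hk : A (k + 2) ≤ A k) :
    A (k + 3) ≤ A (k + 1) := by
  by_cases hN : k ≤ N
  · have e := h.mul_le (k + 1)
    rw [show k + 1 - 1 = k by ring, show k + 1 + 2 = k + 3 by ring,
      show k + 1 + 1 = k + 2 by ring] at e
    refine le_of_mul_le_mul_left (e.trans ?_) (h.pos k h0 hN)
    rw [mul_comm (A k)]
    exact mul_le_mul_of_nonneg_left hk (h.nonneg _)
  · rw [h.eq_zero (k + 3) (by omega)]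
    exact h.nonneg _

/-- Two-step differences that are nonnegative at `k` were so before. -/
theorem le_pred_of_le (h : TwoStepConcave N A) {k : ℤ} (hN : k ≤ N) (hk : A (k - 2) ≤ A k) :
    A (k - 3) ≤ A (k - 1) := by
  by_cases h0 : 0 ≤ k
  · have e := h.mul_le (k - 2)
    rw [show k - 2 - 1 = k - 3 by ring, show k - 2 + 2 = k by ring,
      show k - 2 + 1 = k - 1 by ring] at e
    refine le_of_mul_le_mul_right (e.trans ?_) (h.pos k h0 hN)
    rw [mul_comm]
    exact mul_le_mul_of_nonneg_left hk (h.nonneg _)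
  · rw [h.eq_zero (k - 3) (by omega)]
    exact h.nonneg _

/-- The class is closed under multiplication of generating functions by `l + t X + w X ^ 2`. -/
theorem quadratic_mul (h : TwoStepConcave N A) (hN : 0 ≤ N) {l t w : ℝ} (hl : 0 < l)
    (ht : 0 < t) (hw : 0 < w) {B : ℤ → ℝ}
    (hB : ∀ k, B k = l * A k + t * A (k - 1) + w * A (k - 2)) : TwoStepConcave (N + 2) B := by
  have nn (c : ℝ) (hc : 0 < c) (k : ℤ) : 0 ≤ c * A k := mul_nonneg hc.le (h.nonneg k)
  refine ⟨fun k h0 h2 => ?_, fun k hk => ?_, fun k => ?_⟩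
  · rw [hB]
    have n1 := nn l hl k
    have n2 := nn t ht (k - 1)
    have n3 := nn w hw (k - 2)
    by_cases hk : k ≤ N
    · have := mul_pos hl (h.pos k h0 hk)
      linarith
    by_cases hk' : k - 1 ≤ N
    · have := mul_pos ht (h.pos (k - 1) (by omega) hk')
      linarith
    · have := mul_pos hw (h.pos (k - 2) (by omega) (by omega))
      linarith
  · rw [hB, h.eq_zero k (by omega), h.eq_zero (k - 1) (by omega), h.eq_zero (k - 2) (by omega)]
    ring
  · simp only [hB]
    have e0 := h.mul_le k
    have e1 := h.mul_le (k - 1)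
    have e2 := h.mul_le (k - 2)
    have s0 := h.mul_le_sq k
    have s1 := h.mul_le_sq (k - 1)
    have c0 := h.mul_le_mul_three k
    simp only [show k - 1 - 1 = k - 2 by ring, show k - 1 + 2 = k + 1 by ring,
      show k - 1 + 1 = k by ring, show k - 2 - 1 = k - 3 by ring, show k - 2 + 2 = k by ring,
      show k - 2 + 1 = k - 1 by ring, show k - 1 - 2 = k - 3 by ring,
      show k + 1 - 1 = k by ring, show k + 1 - 2 = k - 1 by ring,
      show k + 2 - 1 = k + 1 by ring, show k + 2 - 2 = k by ring] at *
    have q1 := mul_le_mul_of_nonneg_left e0 (mul_pos hl hl).le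
    have q2 := mul_le_mul_of_nonneg_left e1 (mul_pos ht ht).le
    have q3 := mul_le_mul_of_nonneg_left e2 (mul_pos hw hw).le
    have q4 := mul_le_mul_of_nonneg_left s0 (mul_pos hl ht).le
    have q5 := mul_le_mul_of_nonneg_left s1 (mul_pos ht hw).le
    have q6 := mul_le_mul_of_nonneg_left c0 (mul_pos hl hw).le
    linarith

end TwoStepConcave

/-! ### Location of the sign change -/

section SmoothPoly

variable {ι : Type*} {β : ℝ} {d : ι → ℝ}

/-- The generating polynomial `(1 + X) * ∏ i ∈ s, gamePoly β (d i)`. -/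
noncomputable def smoothPoly (β : ℝ) (d : ι → ℝ) (s : Finset ι) : ℝ[X] :=
  (1 + X) * ∏ i ∈ s, gamePoly β (d i)

theorem smoothPoly_eq_mul_erase [DecidableEq ι] {s : Finset ι} {i : ι} (hi : i ∈ s) :
    smoothPoly β d s = gamePoly β (d i) * smoothPoly β d (s.erase i) := by
  rw [smoothPoly, smoothPoly, ← Finset.mul_prod_erase s _ hi]
  ring

theorem intCoeff_smoothPoly [DecidableEq ι] {s : Finset ι} {i : ι} (hi : i ∈ s) (k : ℤ) :
    intCoeff k (smoothPoly β d s) = (β - d i) * intCoeff k (smoothPoly β d (s.erase i)) +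
      (1 - 2 * β) * intCoeff (k - 1) (smoothPoly β d (s.erase i)) +
      (β + d i) * intCoeff (k - 2) (smoothPoly β d (s.erase i)) := by
  rw [smoothPoly_eq_mul_erase hi, intCoeff_gamePoly_mul]

theorem intCoeff_one (k : ℤ) : intCoeff k 1 = if k = 0 then 1 else 0 := by
  rcases lt_or_ge k 0 with h | h
  · rw [intCoeff_of_neg h, if_neg h.ne]
  · lift k to ℕ using h
    rw [intCoeff_natCast, coeff_one]
    simp

theorem twoStepConcave_smoothPoly (hβ : β < 1 / 2) (s : Finset ι)
    (hd : ∀ i ∈ s, d i ∈ Set.Ioo (-β) β) :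
    TwoStepConcave (2 * s.card + 1) fun k => intCoeff k (smoothPoly β d s) := by
  classical
  induction s using Finset.induction_on with
  | empty =>
    have e (k : ℤ) : intCoeff k (smoothPoly β d ∅) =
        (if k = 0 then 1 else 0) + if k = 1 then 1 else 0 := by
      rw [smoothPoly, Finset.prod_empty, add_mul, one_mul, map_add, intCoeff_X_mul,
        intCoeff_one, intCoeff_one]
      simp only [sub_eq_zero]
    simp only [e, Finset.card_empty]
    refine ⟨fun k h0 h1 => ?_, fun k hk => ?_, fun k => ?_⟩
    · obtain rfl | rfl : k = 0 ∨ k = 1 := by simp at h1; omega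
      all_goals simp
    · rw [if_neg (by simp at hk; omega), if_neg (by simp at hk; omega), add_zero]
    · by_cases hk : k - 1 = 0 ∨ k - 1 = 1
      · rw [if_neg (by omega : ¬ k + 2 = 0), if_neg (by omega : ¬ k + 2 = 1)]
        simp only [add_zero, mul_zero]
        positivity
      · push Not at hk
        rw [if_neg hk.1, if_neg hk.2]
        simp only [add_zero, zero_mul]
        positivity
  | insert i s hi ih =>
    have hdi := hd i (Finset.mem_insert_self i s)
    have h := (ih fun j hj => hd j (Finset.mem_insert_of_mem hj)).quadratic_mul (by positivity)
      (l := β - d i) (t := 1 - 2 * β) (w := β + d i) (by linarith [hdi.2]) (by linarith)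
      (by linarith [hdi.1]) (B := fun k => intCoeff k (smoothPoly β d (insert i s)))
      (fun k => by
        rw [intCoeff_smoothPoly (Finset.mem_insert_self i s), Finset.erase_insert hi])
    rw [Finset.card_insert_of_notMem hi]
    convert h using 1
    push_cast
    ring

/-- The identity behind Darroch's bound on the mode: with `H = (1 + X) * smoothPoly β d s`, it
expresses `(k - M) * H k`, where `M` is the mean of the product of the game polynomials, through
two-step differences of the polynomials with one game removed. -/
theorem sub_mean_mul_intCoeff [DecidableEq ι] (s : Finset ι) (k : ℤ) :
    (k - ∑ i ∈ s, (1 + 2 * d i)) *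
        (intCoeff k (smoothPoly β d s) + intCoeff (k - 1) (smoothPoly β d s)) =
      2 * intCoeff (k - 1) (smoothPoly β d s) +
      ∑ i ∈ s, ((β + d i) * (1 - 2 * d i) *
          (intCoeff (k - 3) (smoothPoly β d (s.erase i)) -
            intCoeff (k - 1) (smoothPoly β d (s.erase i))) +
        (β - d i) * (1 + 2 * d i) *
          (intCoeff (k - 2) (smoothPoly β d (s.erase i)) -
            intCoeff k (smoothPoly β d (s.erase i)))) := by
  have hterm (i : ι) (hi : i ∈ s) :
      (1 + X) ^ 2 * (X * ((∏ j ∈ s.erase i, gamePoly β (d j)) * derivative (gamePoly β (d i)))) =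
      C (1 + 2 * d i) * ((1 + X) * smoothPoly β d s) +
        (C ((β + d i) * (1 - 2 * d i)) * (X * (X ^ 2 * smoothPoly β d (s.erase i)) -
            X * smoothPoly β d (s.erase i)) +
          C ((β - d i) * (1 + 2 * d i)) * (X ^ 2 * smoothPoly β d (s.erase i) -
            smoothPoly β d (s.erase i))) := by
    rw [smoothPoly_eq_mul_erase hi, smoothPoly]
    have hder : derivative (gamePoly β (d i)) = C (1 - 2 * β) + C (2 * (β + d i)) * X := by
      simp only [gamePoly, derivative_add, derivative_C_mul, derivative_C, derivative_X,
        derivative_X_pow, map_mul, map_ofNat, Nat.cast_ofNat]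
      ring
    rw [hder]
    simp only [gamePoly, map_add, map_sub, map_mul, map_one, map_ofNat]
    ring
  have hpoly : X * derivative ((1 + X) * smoothPoly β d s) =
      C 2 * (X * smoothPoly β d s) + ∑ i ∈ s,
        (C (1 + 2 * d i) * ((1 + X) * smoothPoly β d s) +
        (C ((β + d i) * (1 - 2 * d i)) * (X * (X ^ 2 * smoothPoly β d (s.erase i)) -
            X * smoothPoly β d (s.erase i)) +
          C ((β - d i) * (1 + 2 * d i)) * (X ^ 2 * smoothPoly β d (s.erase i) -
            smoothPoly β d (s.erase i)))) := by
    rw [← Finset.sum_congr rfl hterm, ← Finset.mul_sum, ← Finset.mul_sum, ← derivative_prod_finset,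
      smoothPoly]
    simp only [derivative_mul, derivative_add, derivative_one, derivative_X, map_ofNat]
    ring
  have h := congrArg (intCoeff k) hpoly
  rw [intCoeff_X_mul_derivative, map_add, map_sum] at h
  simp only [(intCoeff k).map_add, (intCoeff k).map_sub, intCoeff_C_mul,
    add_mul (1 : ℝ[X]) X, one_mul, intCoeff_X_mul, intCoeff_X_sq_mul] at h
  rw [Finset.sum_add_distrib, ← Finset.sum_mul, show k - 1 - 2 = k - 3 by ring] at h
  linarith

/-- More than two half-points above the mean of the product of the game polynomials, the two-step
differences are nonpositive. -/
theorem intCoeff_add_two_le (hβ : β < 1 / 2) (s : Finset ι)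
    (hd : ∀ i ∈ s, d i ∈ Set.Ioo (-β) β) {k : ℤ} (hk : ∑ i ∈ s, (1 + 2 * d i) + 2 < k) :
    intCoeff (k + 2) (smoothPoly β d s) ≤ intCoeff k (smoothPoly β d s) := by
  classical
  have hA := twoStepConcave_smoothPoly hβ s hd
  have hk2 : 2 < k := by
    have : 0 ≤ ∑ i ∈ s, (1 + 2 * d i) :=
      Finset.sum_nonneg fun i hi => by linarith [(hd i hi).1]
    exact_mod_cast (by linarith : (2 : ℝ) < k)
  by_cases hN : k ≤ 2 * s.card + 1
  swap
  · have e := hA.eq_zero (k + 2) (by omega)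
    exact e.le.trans (hA.nonneg k)
  have hpos : 0 < intCoeff k (smoothPoly β d s) := hA.pos k (by omega) hN
  have hn1 : 0 ≤ intCoeff (k - 1) (smoothPoly β d s) := hA.nonneg (k - 1)
  have hsum : ∑ i ∈ s, (0 : ℝ) < ∑ i ∈ s, ((β + d i) * (1 - 2 * d i) *
          (intCoeff (k - 3) (smoothPoly β d (s.erase i)) -
            intCoeff (k - 1) (smoothPoly β d (s.erase i))) +
        (β - d i) * (1 + 2 * d i) *
          (intCoeff (k - 2) (smoothPoly β d (s.erase i)) -
            intCoeff k (smoothPoly β d (s.erase i)))) := by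
    rw [Finset.sum_const_zero]
    have hid := sub_mean_mul_intCoeff (β := β) (d := d) s k
    -- `A (k - 1) ≤ A k + A (k - 1)`, which costs `2` in the distance from the mean
    have := mul_pos (sub_pos.mpr hk) (add_pos_of_pos_of_nonneg hpos hn1)
    linarith
  obtain ⟨i, hi, hterm⟩ := Finset.exists_lt_of_sum_lt hsum
  have hB := twoStepConcave_smoothPoly (d := d) hβ (s.erase i)
    fun j hj => hd j (Finset.mem_of_mem_erase hj)
  obtain ⟨h1, h2⟩ := hd i hi
  have g0 : intCoeff k (smoothPoly β d (s.erase i)) ≤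
      intCoeff (k - 2) (smoothPoly β d (s.erase i)) := by
    by_contra! hcon
    have hc1 := hB.le_pred_of_lt hcon
    have := mul_nonneg (mul_nonneg (by linarith : 0 ≤ β + d i) (by linarith : 0 ≤ 1 - 2 * d i))
      (sub_nonneg.mpr hc1)
    have := mul_nonneg (mul_nonneg (by linarith : 0 ≤ β - d i) (by linarith : 0 ≤ 1 + 2 * d i))
      (sub_nonneg.mpr hcon.le)
    linarith
  have g1 := hB.le_succ_of_le (k := k - 2) (by omega) (by rwa [sub_add_cancel])
  have g2 := hB.le_succ_of_le (k := k - 1) (by omega)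
    (by rwa [show k - 1 + 2 = k - 2 + 3 by ring, show k - 1 = k - 2 + 1 by ring])
  rw [show k - 2 + 3 = k + 1 by ring, show k - 2 + 1 = k - 1 by ring] at g1
  rw [show k - 1 + 3 = k + 2 by ring, show k - 1 + 1 = k by ring] at g2
  rw [intCoeff_smoothPoly hi, intCoeff_smoothPoly hi k, show k + 2 - 1 = k + 1 by ring,
    show k + 2 - 2 = k by ring]
  gcongr <;> linarith

/-- Below the mean of the product of the game polynomials, the two-step differences are
nonnegative. -/
theorem intCoeff_sub_three_le (hβ : β < 1 / 2) (s : Finset ι)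
    (hd : ∀ i ∈ s, d i ∈ Set.Ioo (-β) β) {k : ℤ} (hk : k < ∑ i ∈ s, (1 + 2 * d i)) :
    intCoeff (k - 3) (smoothPoly β d s) ≤ intCoeff (k - 1) (smoothPoly β d s) := by
  classical
  have hA := twoStepConcave_smoothPoly hβ s hd
  have hN : k < 2 * s.card := by
    have : ∑ i ∈ s, (1 + 2 * d i) ≤ ∑ i ∈ s, (2 : ℝ) :=
      Finset.sum_le_sum fun i hi => by linarith [(hd i hi).2]
    rw [Finset.sum_const, nsmul_eq_mul] at this
    exact_mod_cast (by linarith : (k : ℝ) < 2 * s.card)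
  by_cases hk0 : 0 ≤ k
  swap
  · rw [intCoeff_of_neg (by omega), intCoeff_of_neg (by omega)]
  have hpos : 0 < intCoeff k (smoothPoly β d s) := hA.pos k hk0 (by omega)
  have hn1 : 0 ≤ intCoeff (k - 1) (smoothPoly β d s) := hA.nonneg (k - 1)
  have hsum : ∑ i ∈ s, ((β + d i) * (1 - 2 * d i) *
          (intCoeff (k - 3) (smoothPoly β d (s.erase i)) -
            intCoeff (k - 1) (smoothPoly β d (s.erase i))) +
        (β - d i) * (1 + 2 * d i) *
          (intCoeff (k - 2) (smoothPoly β d (s.erase i)) -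
            intCoeff k (smoothPoly β d (s.erase i)))) < ∑ i ∈ s, (0 : ℝ) := by
    rw [Finset.sum_const_zero]
    have hid := sub_mean_mul_intCoeff (β := β) (d := d) s k
    have := mul_pos (sub_pos.mpr hk) (add_pos_of_pos_of_nonneg hpos hn1)
    linarith
  obtain ⟨i, hi, hterm⟩ := Finset.exists_lt_of_sum_lt hsum
  have hB := twoStepConcave_smoothPoly (d := d) hβ (s.erase i)
    fun j hj => hd j (Finset.mem_of_mem_erase hj)
  have hcard : ((s.erase i).card : ℤ) = s.card - 1 := by
    rw [Finset.card_erase_of_mem hi, Nat.cast_pred (Finset.card_pos.mpr ⟨i, hi⟩)]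
  obtain ⟨h1, h2⟩ := hd i hi
  have g0 : intCoeff (k - 3) (smoothPoly β d (s.erase i)) ≤
      intCoeff (k - 1) (smoothPoly β d (s.erase i)) := by
    by_contra! hcon
    have hc1 := hB.le_succ_of_lt (k := k - 3) (by rwa [show k - 3 + 2 = k - 1 by ring])
    rw [show k - 3 + 3 = k by ring, show k - 3 + 1 = k - 2 by ring] at hc1
    have := mul_nonneg (mul_nonneg (by linarith : 0 ≤ β + d i) (by linarith : 0 ≤ 1 - 2 * d i))
      (sub_nonneg.mpr hcon.le)
    have := mul_nonneg (mul_nonneg (by linarith : 0 ≤ β - d i) (by linarith : 0 ≤ 1 + 2 * d i))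
      (sub_nonneg.mpr hc1)
    linarith
  have g1 := hB.le_pred_of_le (k := k - 1) (by omega) (by rwa [show k - 1 - 2 = k - 3 by ring])
  have g2 := hB.le_pred_of_le (k := k - 2) (by omega)
    (by rwa [show k - 2 - 2 = k - 1 - 3 by ring, show k - 2 = k - 1 - 1 by ring])
  rw [show k - 1 - 3 = k - 4 by ring, show k - 1 - 1 = k - 2 by ring] at g1
  rw [show k - 2 - 3 = k - 5 by ring, show k - 2 - 1 = k - 3 by ring] at g2
  rw [intCoeff_smoothPoly hi, intCoeff_smoothPoly hi (k - 1), show k - 3 - 1 = k - 4 by ring,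
    show k - 3 - 2 = k - 5 by ring, show k - 1 - 1 = k - 2 by ring,
    show k - 1 - 2 = k - 3 by ring]
  gcongr <;> linarith

end SmoothPoly

/-! ### Tail probabilities as tail sums -/

/-- The sum of the coefficients of a polynomial in degrees at least `K`. -/
noncomputable def tailSum (K : ℤ) : ℝ[X] →ₗ[ℝ] ℝ :=
  lsum fun j => if K ≤ j then LinearMap.id else 0

theorem tailSum_monomial (K : ℤ) (j : ℕ) (r : ℝ) :
    tailSum K (monomial j r) = if K ≤ j then r else 0 := by
  rw [tailSum, lsum_apply, sum_monomial_index _ _ (by simp)]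
  split_ifs <;> rfl

theorem tailSum_C_mul (K : ℤ) (r : ℝ) (P : ℝ[X]) : tailSum K (C r * P) = r * tailSum K P := by
  rw [← smul_eq_C_mul, map_smul, smul_eq_mul]

/-- Tail sums telescope against a factor `X - 1`. -/
theorem tailSum_X_sub_one_mul (K : ℤ) (P : ℝ[X]) :
    tailSum K ((X - 1) * P) = intCoeff (K - 1) P := by
  have h : tailSum K ∘ₗ LinearMap.mulLeft ℝ (X - 1 : ℝ[X]) = intCoeff (K - 1) := by
    refine lhom_ext' fun j => LinearMap.ext_ring ?_
    simp only [LinearMap.comp_apply, LinearMap.mulLeft_apply, sub_mul, one_mul, map_sub,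
      X_mul_monomial, tailSum_monomial]
    rcases lt_or_ge (K - 1) 0 with hK | hK
    · rw [intCoeff_of_neg hK, if_pos (by omega), if_pos (by omega), sub_self]
    · obtain ⟨m, hm⟩ := Int.eq_ofNat_of_zero_le hK
      obtain rfl : K = m + 1 := by omega
      rw [hm, intCoeff_natCast, coeff_monomial]
      push_cast
      split_ifs <;> first | omega | norm_num
  exact LinearMap.congr_fun h P

/-- The probability of `c` half-points in one game, where `d = α * s`. -/
noncomputable def outcomeProb (β d : ℝ) : Fin 3 → ℝ := ![β - d, 1 - 2 * β, β + d]

theorem outcomeProb_nonneg {β d : ℝ} (hβ : β ≤ 1 / 2) (hd : d ∈ Set.Ioo (-β) β) (c : Fin 3) :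
    0 ≤ outcomeProb β d c := by
  obtain ⟨h1, h2⟩ := hd
  fin_cases c <;> simp [outcomeProb] <;> linarith

theorem gamePoly_eq_sum (β d : ℝ) :
    gamePoly β d = ∑ c : Fin 3, monomial (c : ℕ) (outcomeProb β d c) := by
  simp only [gamePoly, outcomeProb, Fin.sum_univ_three, ← C_mul_X_pow_eq_monomial]
  simp

theorem gameLaw_eq_sum (α β s : ℝ) :
    gameLaw α β s = ∑ c : Fin 3, ENNReal.ofReal (outcomeProb β (α * s) c) •
      Measure.dirac ((c : ℝ) / 2) := by
  simp only [gameLaw, winProb, tieProb, lossProb, outcomeProb, Fin.sum_univ_three]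
  simp only [Matrix.cons_val]
  norm_num
  rw [add_comm β, sub_eq_neg_add β]
  abel

variable {n : ℕ} {α β : ℝ} {a b : Fin n → ℝ}

instance (s : ℝ) : IsFiniteMeasure (gameLaw α β s) := by
  constructor
  simp [gameLaw]

/-- The joint law as a finite combination of point masses, one for each list of outcomes. -/
theorem seriesLaw_eq_sum (σ : Equiv.Perm (Fin n)) :
    seriesLaw α β a b σ = ∑ c : Fin n → Fin 3,
      (∏ i, ENNReal.ofReal (outcomeProb β (α * (b (σ i) - a i)) (c i))) •
        Measure.dirac fun i => ((c i : ℕ) : ℝ) / 2 := by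
  refine Measure.pi_eq fun S hS => ?_
  simp only [gameLaw_eq_sum, Measure.coe_finsetSum, Finset.sum_apply, Measure.smul_apply,
    smul_eq_mul, Measure.dirac_apply' _ (hS _), Measure.dirac_apply' _ (.univ_pi hS)]
  rw [Finset.prod_univ_sum, Fintype.piFinset_univ]
  refine Finset.sum_congr rfl fun c _ => ?_
  rw [Finset.prod_mul_distrib]
  congr 1
  by_cases h : ∀ i, ((c i : ℕ) : ℝ) / 2 ∈ S i
  · rw [Set.indicator_of_mem (by simpa using h)]
    simp [h]
  · rw [Set.indicator_of_notMem (by simpa using h)]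
    push Not at h
    obtain ⟨i, hi⟩ := h
    rw [Finset.prod_eq_zero (Finset.mem_univ i) (by simp [hi])]

theorem Admissible.mem_Ioo (hα : 0 < α) (h : Admissible α β a b) (i j : Fin n) :
    α * (b j - a i) ∈ Set.Ioo (-β) β := by
  have := h.probs_pos hα i j
  simp only [winProb, lossProb] at this
  exact ⟨by linarith, by linarith⟩

theorem tailProb_eq_tailSum (hα : 0 < α) (hβ : β ≤ 1 / 2) (h : Admissible α β a b)
    (σ : Equiv.Perm (Fin n)) (K : ℤ) :
    tailProb α β a b σ (K / 2) =
      tailSum K (∏ i, gamePoly β (α * (b (σ i) - a i))) := by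
  have hp (i : Fin n) (c : Fin 3) : 0 ≤ outcomeProb β (α * (b (σ i) - a i)) c :=
    outcomeProb_nonneg hβ (h.mem_Ioo hα i (σ i)) c
  have hmon (c : Fin n → Fin 3) :
      ∏ i, monomial (c i : ℕ) (outcomeProb β (α * (b (σ i) - a i)) (c i)) =
        monomial (∑ i, (c i : ℕ)) (∏ i, outcomeProb β (α * (b (σ i) - a i)) (c i)) := by
    simp only [← C_mul_X_pow_eq_monomial, Finset.prod_mul_distrib, map_prod,
      Finset.prod_pow_eq_pow_sum]
  have hmeas : MeasurableSet {x : Fin n → ℝ | (K : ℝ) / 2 ≤ ∑ i, x i} :=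
    measurableSet_le measurable_const (by fun_prop)
  simp only [gamePoly_eq_sum]
  rw [Finset.prod_univ_sum, Fintype.piFinset_univ, map_sum, tailProb, seriesLaw_eq_sum,
    measureReal_def, Measure.coe_finsetSum, Finset.sum_apply, ENNReal.toReal_sum]
  · refine Finset.sum_congr rfl fun c _ => ?_
    rw [hmon, tailSum_monomial, Measure.smul_apply, Measure.dirac_apply' _ hmeas,
      ← ENNReal.ofReal_prod_of_nonneg fun i _ => hp i _]
    have hiff : (fun i => ((c i : ℕ) : ℝ) / 2) ∈ {x : Fin n → ℝ | (K : ℝ) / 2 ≤ ∑ i, x i} ↔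
        K ≤ ((∑ i, (c i : ℕ) : ℕ) : ℤ) := by
      rw [Set.mem_ofPred_eq, ← Finset.sum_div, div_le_div_iff_of_pos_right two_pos]
      exact_mod_cast Iff.rfl
    rw [Set.indicator_apply]
    simp only [hiff]
    split_ifs
    · simp [ENNReal.toReal_ofReal (Finset.prod_nonneg fun i _ => hp i (c i))]
    · simp
  · intro c _
    rw [Measure.smul_apply, smul_eq_mul]
    exact ENNReal.mul_ne_top (ENNReal.prod_ne_top fun _ _ => ENNReal.ofReal_ne_top)
      (measure_ne_top _ _)

/-! ### Exchanging two opponents -/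

/-- Two games with differentials `d₁, d₂` versus `e₁, e₂` of equal sum: only the product of the
differentials matters. -/
theorem gamePoly_mul_sub_gamePoly_mul {d₁ d₂ e₁ e₂ : ℝ} (h : e₁ + e₂ = d₁ + d₂) :
    gamePoly β e₁ * gamePoly β e₂ - gamePoly β d₁ * gamePoly β d₂ =
      C (e₁ * e₂ - d₁ * d₂) * (X ^ 2 - 1) ^ 2 := by
  obtain rfl : e₁ = d₁ + d₂ - e₂ := by linarith
  simp only [gamePoly, map_add, map_sub, map_mul]
  ring

/-- The effect on the tail probability of exchanging the opponents of players `i` and `j` of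
team `A`, in terms of the remaining games. -/
theorem tailProb_mul_swap_sub (hα : 0 < α) (hβ : β ≤ 1 / 2) (h : Admissible α β a b)
    (σ : Equiv.Perm (Fin n)) {i j : Fin n} (hij : i ≠ j) (K : ℤ) :
    tailProb α β a b (σ * Equiv.swap i j) (K / 2) - tailProb α β a b σ (K / 2) =
      α ^ 2 * ((a i - a j) * (b (σ j) - b (σ i))) *
        (intCoeff (K - 3) (smoothPoly β (fun r => α * (b (σ r) - a r)) {i, j}ᶜ) -
          intCoeff (K - 1) (smoothPoly β (fun r => α * (b (σ r) - a r)) {i, j}ᶜ)) := by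
  have hsplit (f : Fin n → ℝ[X]) : ∏ r, f r = f i * f j * ∏ r ∈ {i, j}ᶜ, f r := by
    rw [← Finset.prod_mul_prod_compl {i, j}, Finset.prod_pair hij]
  have hrest : ∏ r ∈ {i, j}ᶜ, gamePoly β (α * (b ((σ * Equiv.swap i j) r) - a r)) =
      ∏ r ∈ {i, j}ᶜ, gamePoly β (α * (b (σ r) - a r)) := by
    refine Finset.prod_congr rfl fun r hr => ?_
    simp only [Finset.mem_compl, Finset.mem_insert, Finset.mem_singleton, not_or] at hr
    rw [Equiv.Perm.mul_apply, Equiv.swap_apply_of_ne_of_ne hr.1 hr.2]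
  rw [tailProb_eq_tailSum hα hβ h, tailProb_eq_tailSum hα hβ h, ← map_sub, hsplit,
    hsplit fun r => gamePoly β (α * (b (σ r) - a r)), hrest, ← sub_mul, Equiv.Perm.mul_apply,
    Equiv.Perm.mul_apply, Equiv.swap_apply_left, Equiv.swap_apply_right,
    gamePoly_mul_sub_gamePoly_mul (by ring)]
  have e (c : ℝ) : C c * (X ^ 2 - 1) ^ 2 * ∏ r ∈ {i, j}ᶜ, gamePoly β (α * (b (σ r) - a r)) =
      C c * ((X - 1) * (X ^ 2 * smoothPoly β (fun r => α * (b (σ r) - a r)) {i, j}ᶜ -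
        smoothPoly β (fun r => α * (b (σ r) - a r)) {i, j}ᶜ)) := by
    rw [smoothPoly]
    ring
  rw [e, tailSum_C_mul, tailSum_X_sub_one_mul, map_sub, intCoeff_X_sq_mul,
    show K - 1 - 2 = K - 3 by ring]
  ring

theorem two_mul_meanScore (hα : 0 < α) (hβ : β ≤ 1 / 2) (h : Admissible α β a b)
    (σ : Equiv.Perm (Fin n)) :
    2 * meanScore α β a b = ∑ i, (1 + 2 * (α * (b (σ i) - a i))) := by
  rw [← expectedScore_eq_meanScore hα hβ h σ, expectedScore_eq hα hβ h]
  simp only [Finset.sum_add_distrib, ← Finset.mul_sum, Finset.sum_sub_distrib]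
  rw [Equiv.sum_comp σ b]
  simp
  ring

/-- The mean of the remaining games when `i` and `j` are left out. -/
theorem sum_compl_pair (hα : 0 < α) (hβ : β ≤ 1 / 2) (h : Admissible α β a b)
    (σ : Equiv.Perm (Fin n)) {i j : Fin n} (hij : i ≠ j) :
    ∑ r ∈ {i, j}ᶜ, (1 + 2 * (α * (b (σ r) - a r))) = 2 * meanScore α β a b - 2 -
      2 * (α * (b (σ i) - a i)) - 2 * (α * (b (σ j) - a j)) := by
  rw [two_mul_meanScore hα hβ h σ, ← Finset.sum_add_sum_compl {i, j}, Finset.sum_pair hij]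
  ring

/-- Far above the mean, undoing an inversion does not decrease the tail probability. -/
theorem tailProb_le_mul_swap_of_inversion (hα : 0 < α) (hβ : β < 1 / 2) (h : Admissible α β a b)
    {K : ℤ} (hK : meanScore α β a b + 5 / 2 ≤ K / 2) (σ : Equiv.Perm (Fin n)) {i j : Fin n}
    (hij : i < j) (hσ : σ j < σ i) :
    tailProb α β a b σ (K / 2) ≤ tailProb α β a b (σ * Equiv.swap i j) (K / 2) := by
  rw [← sub_nonneg, tailProb_mul_swap_sub hα hβ.le h σ hij.ne]
  have h1 := h.mem_Ioo hα i (σ i)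
  have h2 := h.mem_Ioo hα j (σ j)
  have hm := intCoeff_add_two_le (d := fun r => α * (b (σ r) - a r)) hβ {i, j}ᶜ
    (fun r _ => h.mem_Ioo hα r (σ r)) (k := K - 3) (by
      rw [sum_compl_pair hα hβ.le h σ hij.ne]
      push_cast
      linarith [h1.1, h2.1])
  rw [show K - 3 + 2 = K - 1 by ring] at hm
  exact mul_nonneg (mul_nonneg (sq_nonneg _) (mul_nonneg
    (sub_nonneg.mpr (h.antitone_left hij.le)) (sub_nonneg.mpr (h.antitone_right hσ.le))))
    (sub_nonneg.mpr hm)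

/-- Far below the mean, creating an inversion does not decrease the tail probability. -/
theorem tailProb_le_mul_swap_of_not_inversion (hα : 0 < α) (hβ : β < 1 / 2)
    (h : Admissible α β a b) {K : ℤ} (hK : K / 2 ≤ meanScore α β a b - 2)
    (σ : Equiv.Perm (Fin n)) {i j : Fin n} (hij : i < j) (hσ : σ i < σ j) :
    tailProb α β a b σ (K / 2) ≤ tailProb α β a b (σ * Equiv.swap i j) (K / 2) := by
  rw [← sub_nonneg, tailProb_mul_swap_sub hα hβ.le h σ hij.ne]
  have h1 := h.mem_Ioo hα i (σ i)
  have h2 := h.mem_Ioo hα j (σ j)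
  have hm := intCoeff_sub_three_le (d := fun r => α * (b (σ r) - a r)) hβ {i, j}ᶜ
    (fun r _ => h.mem_Ioo hα r (σ r)) (k := K) (by
      rw [sum_compl_pair hα hβ.le h σ hij.ne]
      linarith [h1.2, h2.2])
  exact mul_nonneg_of_nonpos_of_nonpos (mul_nonpos_of_nonneg_of_nonpos (sq_nonneg _)
    (mul_nonpos_of_nonneg_of_nonpos (sub_nonneg.mpr (h.antitone_left hij.le))
      (sub_nonpos.mpr (h.antitone_right hσ.le)))) (sub_nonpos.mpr hm)

/-! ### Sorting by exchanges -/

/-- A function on permutations that does not decrease when an inversion is undone is maximal at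
the identity. -/
theorem le_one_of_le_mul_swap (F : Equiv.Perm (Fin n) → ℝ)
    (hF : ∀ (σ : Equiv.Perm (Fin n)) (i j : Fin n), i < j → σ j < σ i →
      F σ ≤ F (σ * Equiv.swap i j)) (τ : Equiv.Perm (Fin n)) : F τ ≤ F 1 := by
  -- among the maximizers of `F`, take one that maximizes `∑ i, i * σ i`
  obtain ⟨σ, hσ⟩ := Finite.exists_max fun σ : Equiv.Perm (Fin n) =>
    toLex (F σ, ∑ r : Fin n, (r : ℤ) * (σ r : ℤ))
  have hmax (τ) : F τ ≤ F σ := by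
    have := hσ τ
    rw [Prod.Lex.le_iff] at this
    rcases this with h | h
    · exact h.le
    · exact h.1.le
  have hmono : StrictMono σ := by
    intro i j hij
    by_contra! hji
    have hlt : σ j < σ i := lt_of_le_of_ne hji (σ.injective.ne hij.ne')
    have := hσ (σ * Equiv.swap i j)
    rw [Prod.Lex.le_iff] at this
    rcases this with h | h
    · exact absurd (hF σ i j hij hlt) (not_le.mpr h)
    · have hs := h.2
      have hsplit (f : Fin n → ℤ) : ∑ r, f r = f i + f j + ∑ r ∈ {i, j}ᶜ, f r := by
        rw [← Finset.sum_add_sum_compl {i, j}, Finset.sum_pair hij.ne]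
      have hrest : ∑ r ∈ {i, j}ᶜ, (r : ℤ) * ((σ * Equiv.swap i j) r : ℤ) =
          ∑ r ∈ {i, j}ᶜ, (r : ℤ) * (σ r : ℤ) := by
        refine Finset.sum_congr rfl fun r hr => ?_
        simp only [Finset.mem_compl, Finset.mem_insert, Finset.mem_singleton, not_or] at hr
        rw [Equiv.Perm.mul_apply, Equiv.swap_apply_of_ne_of_ne hr.1 hr.2]
      simp only [ofLex_toLex] at hs
      rw [hsplit, hsplit fun r => (r : ℤ) * (σ r : ℤ), hrest, Equiv.Perm.mul_apply,
        Equiv.Perm.mul_apply, Equiv.swap_apply_left, Equiv.swap_apply_right] at hs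
      have h1 : ((i : ℕ) : ℤ) < (j : ℕ) := by exact_mod_cast hij
      have h2 : ((σ j : ℕ) : ℤ) < (σ i : ℕ) := by exact_mod_cast hlt
      nlinarith
  obtain rfl : σ = 1 := by
    ext r
    rw [Equiv.Perm.one_apply, (hmono.range_inj strictMono_id).mp (by simp [σ.surjective.range_eq])]
    rfl
  exact hmax τ

theorem isOptimal_one (hα : 0 < α) (hβ : β < 1 / 2) (h : Admissible α β a b)
    {K : ℤ} (hK : meanScore α β a b + 5 / 2 ≤ K / 2) : IsOptimal α β a b (K / 2) 1 :=
  le_one_of_le_mul_swap _ fun σ _ _ => tailProb_le_mul_swap_of_inversion hα hβ h hK σ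

theorem isOptimal_revPerm (hα : 0 < α) (hβ : β < 1 / 2) (h : Admissible α β a b)
    {K : ℤ} (hK : K / 2 ≤ meanScore α β a b - 2) : IsOptimal α β a b (K / 2) Fin.revPerm := by
  intro τ
  have key := le_one_of_le_mul_swap
    (fun σ => tailProb α β a b (Fin.revPerm * σ) (K / 2)) (fun σ i j hij hσ => by
      rw [← mul_assoc]
      exact tailProb_le_mul_swap_of_not_inversion hα hβ h hK _ hij (by simpa using hσ))
    (Fin.revPerm⁻¹ * τ)
  simpa using key

/-! ### Dependence on the teams near the mean -/

theorem continuous_intCoeff_smoothPoly {ι : Type*} (β : ℝ) (s : Finset ι) (k : ℤ) :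
    Continuous fun x : ℝ => intCoeff k (smoothPoly β (fun _ => x) s) := by
  classical
  induction s using Finset.induction_on generalizing k with
  | empty => simpa [smoothPoly] using continuous_const
  | insert i s hi ih =>
    simp only [intCoeff_smoothPoly (Finset.mem_insert_self i s), Finset.erase_insert hi]
    exact (((continuous_const.sub continuous_id).mul (ih k)).add
      (continuous_const.mul (ih (k - 1)))).add
      ((continuous_const.add continuous_id).mul (ih (k - 2)))

theorem gamePoly_self (β : ℝ) : gamePoly β β = X * (C (1 - 2 * β) + C (2 * β) * X) := by
  simp only [gamePoly, map_add, map_sub, map_mul, map_one, map_ofNat]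
  ring

theorem gamePoly_neg_self (β : ℝ) : gamePoly β (-β) = C (2 * β) + C (1 - 2 * β) * X := by
  simp only [gamePoly, map_add, map_sub, map_mul, map_one, map_ofNat, map_neg]
  ring

theorem coeff_C_add_C_mul_X_pow (p q : ℝ) {m k : ℕ} (hk : k ≤ m) :
    ((C p + C q * X) ^ m).coeff k = q ^ k * p ^ (m - k) * m.choose k := by
  have hterm (i : ℕ) : (C q * X) ^ i * C p ^ (m - i) * (m.choose i : ℝ[X]) =
      C (q ^ i * p ^ (m - i) * m.choose i) * X ^ i := by
    simp only [map_mul, map_pow, map_natCast]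
    ring
  rw [add_comm, add_pow, finsetSum_coeff]
  simp only [hterm, coeff_C_mul_X_pow]
  rw [Finset.sum_ite_eq, if_pos (Finset.mem_range.mpr (by omega))]

theorem intCoeff_C_add_C_mul_X_pow_nonneg {p q : ℝ} (hp : 0 ≤ p) (hq : 0 ≤ q) (m : ℕ) (k : ℤ) :
    0 ≤ intCoeff k ((C p + C q * X) ^ m) := by
  induction m generalizing k with
  | zero => rw [pow_zero, intCoeff_one]; positivity
  | succ m ih =>
    rw [pow_succ', add_mul, mul_assoc, map_add, intCoeff_C_mul, intCoeff_C_mul, intCoeff_X_mul]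
    exact add_nonneg (mul_nonneg hp (ih k)) (mul_nonneg hq (ih _))

theorem intCoeff_X_pow_mul (m : ℕ) (k : ℤ) (P : ℝ[X]) :
    intCoeff k (X ^ m * P) = intCoeff (k - m) P := by
  induction m generalizing k with
  | zero => simp
  | succ m ih =>
    rw [pow_succ', mul_assoc, intCoeff_X_mul, ih]
    congr 2
    push_cast
    ring

/-- The two-step difference that governs the exchange of two games at threshold `K = m + 2`, when
the `m` remaining games all have `α * s = x`. -/
noncomputable def middleDiff (β : ℝ) (m : ℕ) (x : ℝ) : ℝ :=
  intCoeff (m - 1) (smoothPoly β (fun _ => x) (Finset.range m)) -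
    intCoeff (m + 1) (smoothPoly β (fun _ => x) (Finset.range m))

theorem smoothPoly_const {ι : Type*} (β x : ℝ) (s : Finset ι) :
    smoothPoly β (fun _ => x) s = (1 + X) * gamePoly β x ^ s.card := by
  rw [smoothPoly, Finset.prod_const]

/-- For `x = β` a game is never lost, so the `m` remaining games give at least `m` half-points and
the coefficient at `m - 1` vanishes. -/
theorem middleDiff_self_neg (hβ : β ∈ Set.Ioo (0 : ℝ) (1 / 2)) (m : ℕ) :
    middleDiff β m β < 0 := by
  obtain ⟨h0, h1⟩ := hβ
  have e : smoothPoly β (fun _ => β) (Finset.range m) = X ^ m *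
      ((C (1 - 2 * β) + C (2 * β) * X) ^ m + X * (C (1 - 2 * β) + C (2 * β) * X) ^ m) := by
    rw [smoothPoly_const, gamePoly_self, mul_pow, Finset.card_range]
    ring
  have hc := coeff_C_add_C_mul_X_pow (1 - 2 * β) (2 * β) m.zero_le
  have hn := intCoeff_C_add_C_mul_X_pow_nonneg (by linarith : 0 ≤ 1 - 2 * β)
    (by linarith : 0 ≤ 2 * β) m 1
  have hp : 0 < (1 - 2 * β) ^ m := pow_pos (by linarith) _
  rw [← intCoeff_natCast, Nat.cast_zero, pow_zero, Nat.sub_zero, Nat.choose_zero_right,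
    Nat.cast_one, one_mul, mul_one] at hc
  rw [middleDiff, e, intCoeff_X_pow_mul, intCoeff_of_neg (by omega), intCoeff_X_pow_mul,
    add_sub_cancel_left, map_add, intCoeff_X_mul, sub_self, hc]
  linarith

/-- For `x = -β` a game is never won, so the `m` remaining games give at most `m` half-points. The
coefficient at `m + 1` is then the probability `(1 - 2β) ^ m` that all are tied, and the one at
`m - 1` is at least the probability `2β m (1 - 2β) ^ (m - 1)` that exactly one is lost. -/
theorem middleDiff_neg_self_pos (hβ : β ∈ Set.Ioo (0 : ℝ) (1 / 2)) {m : ℕ} (hm : 1 ≤ m)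
    (hcard : 1 < 2 * β * (m + 1)) : 0 < middleDiff β m (-β) := by
  obtain ⟨h0, h1⟩ := hβ
  have e : smoothPoly β (fun _ => -β) (Finset.range m) = (C (2 * β) + C (1 - 2 * β) * X) ^ m +
      X * (C (2 * β) + C (1 - 2 * β) * X) ^ m := by
    rw [smoothPoly_const, gamePoly_neg_self, Finset.card_range]
    ring
  have hn := intCoeff_C_add_C_mul_X_pow_nonneg (by linarith : 0 ≤ 2 * β)
    (by linarith : 0 ≤ 1 - 2 * β) m (m - 1 - 1)
  have hdeg : ((C (2 * β) + C (1 - 2 * β) * X) ^ m).coeff (m + 1) = 0 := by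
    refine coeff_eq_zero_of_natDegree_lt (Nat.lt_succ_of_le (natDegree_pow_le.trans ?_))
    have h : (C (2 * β) + C (1 - 2 * β) * X).natDegree ≤ 1 := by compute_degree
    simpa using Nat.mul_le_mul_left m h
  have hc1 := coeff_C_add_C_mul_X_pow (2 * β) (1 - 2 * β) (le_refl m)
  have hc2 := coeff_C_add_C_mul_X_pow (2 * β) (1 - 2 * β) (Nat.sub_le m 1)
  rw [← intCoeff_natCast] at hc1 hc2 hdeg
  rw [Nat.sub_self, pow_zero, mul_one, Nat.choose_self, Nat.cast_one, mul_one] at hc1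
  rw [Nat.cast_sub hm, Nat.cast_one, Nat.sub_sub_self hm, pow_one, Nat.choose_symm hm,
    Nat.choose_one_right] at hc2
  rw [Nat.cast_add, Nat.cast_one] at hdeg
  rw [middleDiff, e, map_add, map_add, intCoeff_X_mul, intCoeff_X_mul, add_sub_cancel_right,
    hc1, hc2, hdeg, ← pow_sub_one_mul (Nat.one_le_iff_ne_zero.mp hm) (1 - 2 * β)]
  have hp : 0 < (1 - 2 * β) ^ (m - 1) := pow_pos (by linarith) _
  have hq : 0 < (1 - 2 * β) ^ (m - 1) * (2 * β * (m + 1) - 1) := mul_pos hp (by linarith)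
  linarith

theorem continuous_middleDiff (β : ℝ) (m : ℕ) : Continuous (middleDiff β m) :=
  (continuous_intCoeff_smoothPoly β _ _).sub (continuous_intCoeff_smoothPoly β _ _)

/-- Strengths of a team whose first player exceeds the common level `x / α` by `ε / α`. -/
noncomputable def leaderTeam (n : ℕ) (α x ε : ℝ) (i : Fin (n + 1)) : ℝ :=
  (x + if i = 0 then ε else 0) / α

theorem antitone_leaderTeam (n : ℕ) (hα : 0 < α) (x : ℝ) {ε : ℝ} (hε : 0 ≤ ε) :
    Antitone (leaderTeam n α x ε) := by
  intro i j hij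
  refine div_le_div_of_nonneg_right (add_le_add_right ?_ x) hα.le
  by_cases hj : j = 0
  · obtain rfl : i = 0 := by simpa [hj] using hij
    rw [hj]
  · rw [if_neg hj]
    positivity

theorem admissible_leaderTeam (n : ℕ) (hα : 0 < α) (hβ : β < 1 / 2) {x ε : ℝ} (hε : 0 ≤ ε)
    (hx : |x| + ε < β) : Admissible α β (leaderTeam n α 0 ε) (leaderTeam n α x ε) := by
  refine ⟨antitone_leaderTeam n hα 0 hε, antitone_leaderTeam n hα x hε, fun i j => ?_⟩
  have h1 := neg_abs_le x
  have h2 := le_abs_self x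
  rw [leaderTeam, leaderTeam, ← sub_div]
  refine ⟨⟨?_, ?_⟩, ?_, ?_⟩
  · rw [← neg_div, div_lt_div_iff_of_pos_right hα]
    split_ifs <;> linarith
  all_goals
    rw [div_lt_div_iff_of_pos_right hα]
    split_ifs <;> linarith

theorem meanScore_leaderTeam (n : ℕ) (hα : 0 < α) (hβ : β < 1 / 2) {x ε : ℝ} (hε : 0 ≤ ε)
    (hx : |x| + ε < β) :
    meanScore α β (leaderTeam n α 0 ε) (leaderTeam n α x ε) = (n + 1) / 2 + (n + 1) * x := by
  rw [meanScore, expectedScore_eq hα hβ.le (admissible_leaderTeam n hα hβ hε hx)]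
  simp only [leaderTeam, ← Finset.sum_div, Finset.sum_add_distrib, Finset.sum_ite_eq',
    Finset.sum_const, Finset.card_univ, Fintype.card_fin, Finset.mem_univ, if_true, smul_zero,
    nsmul_eq_mul]
  field_simp
  push_cast
  ring

/-- Exchanging the opponents of the leader and of player `j` of team `A`, in a match in which one
of these two opponents is the leader of team `B`. -/
theorem tailProb_leaderTeam_mul_swap_sub (m : ℕ) (hα : 0 < α) (hβ : β < 1 / 2) {x ε : ℝ}
    (hε : 0 ≤ ε) (hx : |x| + ε < β) (σ : Equiv.Perm (Fin (m + 2))) {j : Fin (m + 2)}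
    (hj : 0 ≠ j) (hσ : σ 0 = 0 ∨ σ j = 0) :
    tailProb α β (leaderTeam (m + 1) α 0 ε) (leaderTeam (m + 1) α x ε) (σ * Equiv.swap 0 j)
        (((m + 2 : ℕ) : ℤ) / 2) -
      tailProb α β (leaderTeam (m + 1) α 0 ε) (leaderTeam (m + 1) α x ε) σ
        (((m + 2 : ℕ) : ℤ) / 2) =
      (if σ 0 = 0 then -1 else 1) * ε ^ 2 * middleDiff β m x := by
  have hcard : ({0, j}ᶜ : Finset (Fin (m + 2))).card = m := by
    rw [Finset.card_compl, Finset.card_pair hj, Fintype.card_fin, Nat.add_sub_cancel]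
  have hconst : smoothPoly β (fun r => α * (leaderTeam (m + 1) α x ε (σ r) -
        leaderTeam (m + 1) α 0 ε r)) {0, j}ᶜ = smoothPoly β (fun _ => x) (Finset.range m) := by
    rw [smoothPoly_const, Finset.card_range, smoothPoly]
    congr 1
    refine (Finset.prod_eq_pow_card (b := gamePoly β x) fun r hr => ?_).trans (by rw [hcard])
    simp only [Finset.mem_compl, Finset.mem_insert, Finset.mem_singleton, not_or] at hr
    have hσr : σ r ≠ 0 := by
      rcases hσ with h | h <;> rw [← h] <;> exact σ.injective.ne (by tauto)
    rw [leaderTeam, leaderTeam, if_neg hr.1, if_neg hσr]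
    congr 1
    field_simp
    ring
  rw [tailProb_mul_swap_sub hα hβ.le (admissible_leaderTeam _ hα hβ hε hx) σ hj, hconst,
    middleDiff]
  have hK1 : ((m + 2 : ℕ) : ℤ) - 3 = m - 1 := by push_cast; ring
  have hK2 : ((m + 2 : ℕ) : ℤ) - 1 = m + 1 := by push_cast; ring
  rw [hK1, hK2]
  congr 1
  simp only [leaderTeam]
  by_cases h0 : σ 0 = 0
  · have hσj : σ j ≠ 0 := by rw [← h0]; exact σ.injective.ne hj.symm
    rw [if_pos trivial, if_neg hj.symm, if_neg hσj, if_pos h0, if_pos h0]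
    field_simp
    ring
  · rw [if_pos trivial, if_neg hj.symm, if_pos (hσ.resolve_left h0), if_neg h0, if_neg h0]
    field_simp
    ring

/-- For a negative middle difference, the leaders of the two teams do not meet in an optimal
ordering. -/
theorem IsOptimal.apply_zero_ne (hα : 0 < α) (hβ : β < 1 / 2) {m : ℕ} {x ε : ℝ} (hε : 0 < ε)
    (hx : |x| + ε < β) (hneg : middleDiff β m x < 0) {σ : Equiv.Perm (Fin (m + 2))}
    (h : IsOptimal α β (leaderTeam (m + 1) α 0 ε) (leaderTeam (m + 1) α x ε)
      (((m + 2 : ℕ) : ℤ) / 2) σ) : σ 0 ≠ 0 := by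
  intro h0
  have hs := tailProb_leaderTeam_mul_swap_sub m hα hβ hε.le hx σ (j := 1) zero_ne_one (.inl h0)
  have ho := h (σ * Equiv.swap 0 1)
  rw [if_pos h0] at hs
  nlinarith [mul_pos (pow_pos hε 2) (neg_pos.mpr hneg)]

/-- For a positive middle difference, the leaders of the two teams meet in every optimal
ordering. -/
theorem IsOptimal.apply_zero_eq (hα : 0 < α) (hβ : β < 1 / 2) {m : ℕ} {x ε : ℝ} (hε : 0 < ε)
    (hx : |x| + ε < β) (hpos : 0 < middleDiff β m x) {σ : Equiv.Perm (Fin (m + 2))}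
    (h : IsOptimal α β (leaderTeam (m + 1) α 0 ε) (leaderTeam (m + 1) α x ε)
      (((m + 2 : ℕ) : ℤ) / 2) σ) : σ 0 = 0 := by
  by_contra h0
  have hne : 0 ≠ σ⁻¹ 0 := fun he => h0 (by rw [← Equiv.Perm.eq_inv_iff_eq, ← he])
  have hs := tailProb_leaderTeam_mul_swap_sub m hα hβ hε.le hx σ hne
    (.inr (by simp))
  have ho := h (σ * Equiv.swap 0 (σ⁻¹ 0))
  rw [if_neg h0] at hs
  nlinarith [mul_pos (pow_pos hε 2) hpos]

/-- The threshold `(m + 2) / 2` lies near the mean when `m` is not much larger than `1 / (2β)`. -/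
theorem mem_Ioo_meanScore_leaderTeam (hα : 0 < α) (hβ : β < 1 / 2) {m : ℕ}
    (hm : 2 * β * m ≤ 1) {x ε : ℝ} (hε : 0 ≤ ε) (hx : |x| + ε < β) :
    ((((m + 2 : ℕ) : ℤ) / 2 : ℝ)) ∈ Set.Ioo
      (meanScore α β (leaderTeam (m + 1) α 0 ε) (leaderTeam (m + 1) α x ε) - 2)
      (meanScore α β (leaderTeam (m + 1) α 0 ε) (leaderTeam (m + 1) α x ε) + 5 / 2) := by
  rw [meanScore_leaderTeam (m + 1) hα hβ hε hx]
  have hx' : |((m : ℝ) + 2) * x| ≤ ((m : ℝ) + 2) * β := by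
    rw [abs_mul, abs_of_nonneg (by positivity)]
    exact mul_le_mul_of_nonneg_left (by linarith) (by positivity)
  obtain ⟨h1, h2⟩ := abs_le.mp hx'
  push_cast
  constructor <;> linarith

end LinearMatch

theorem theorem5p2 (α β : ℝ) (hα : 0 < α) (hβ : β ∈ Set.Ioo (0 : ℝ) (1 / 2)) :
    (∀ (n : ℕ) (a b : Fin n → ℝ), LinearMatch.Admissible α β a b →
      ∀ k : ℝ, LinearMatch.IsHalfIntegral k →
        (LinearMatch.meanScore α β a b + 5 / 2 ≤ k →
          LinearMatch.IsOptimal α β a b k 1) ∧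
        (k ≤ LinearMatch.meanScore α β a b - 2 →
          LinearMatch.IsOptimal α β a b k Fin.revPerm)) ∧
    (∃ (n : ℕ) (k : ℝ) (a b a' b' : Fin n → ℝ),
      LinearMatch.IsHalfIntegral k ∧
      LinearMatch.Admissible α β a b ∧ LinearMatch.Admissible α β a' b' ∧
      k ∈ Set.Ioo (LinearMatch.meanScore α β a b - 2)
        (LinearMatch.meanScore α β a b + 5 / 2) ∧
      k ∈ Set.Ioo (LinearMatch.meanScore α β a' b' - 2)
        (LinearMatch.meanScore α β a' b' + 5 / 2) ∧
      ¬ ∃ σ : Equiv.Perm (Fin n),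
        LinearMatch.IsOptimal α β a b k σ ∧ LinearMatch.IsOptimal α β a' b' k σ) := by
  refine ⟨fun n a b h k hk => ?_, ?_⟩
  · obtain ⟨K, rfl⟩ := hk
    exact ⟨LinearMatch.isOptimal_one hα hβ.2 h, LinearMatch.isOptimal_revPerm hα hβ.2 h⟩
  · obtain ⟨h0, h1⟩ := hβ
    -- `m` is the largest integer with `2 * β * m ≤ 1`
    obtain ⟨m, hm⟩ : ∃ m : ℕ, m = ⌊1 / (2 * β)⌋₊ := ⟨_, rfl⟩
    have hm1 : 2 * β * m ≤ 1 := by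
      have := Nat.floor_le (by positivity : 0 ≤ 1 / (2 * β))
      rw [← hm, le_div_iff₀ (by linarith)] at this
      linarith
    have hm2 : 1 < 2 * β * (m + 1) := by
      have := Nat.lt_floor_add_one (1 / (2 * β))
      rw [← hm, div_lt_iff₀ (by linarith)] at this
      linarith
    have hm0 : 1 ≤ m := by
      rw [hm, Nat.one_le_floor_iff, le_div_iff₀ (by linarith)]
      linarith
    have hc := LinearMatch.continuous_middleDiff β m
    obtain ⟨x, hx, hxβ⟩ : ∃ x, LinearMatch.middleDiff β m x < 0 ∧ |x| < β := by
      have e1 : ∀ᶠ x in nhdsWithin β (Set.Iio β), LinearMatch.middleDiff β m x < 0 :=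
        (hc.tendsto β).eventually_lt_const
          (LinearMatch.middleDiff_self_neg ⟨h0, h1⟩ m) |>.filter_mono nhdsWithin_le_nhds
      have e2 : ∀ᶠ x in nhdsWithin β (Set.Iio β), x ∈ Set.Ioo (-β) β :=
        Ioo_mem_nhdsLT (by linarith)
      obtain ⟨x, hx1, hx2⟩ := (e1.and e2).exists
      exact ⟨x, hx1, abs_lt.mpr hx2⟩
    obtain ⟨y, hy, hyβ⟩ : ∃ y, 0 < LinearMatch.middleDiff β m y ∧ |y| < β := by
      have e1 : ∀ᶠ y in nhdsWithin (-β) (Set.Ioi (-β)), 0 < LinearMatch.middleDiff β m y :=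
        (hc.tendsto (-β)).eventually_const_lt
          (LinearMatch.middleDiff_neg_self_pos ⟨h0, h1⟩ hm0 hm2) |>.filter_mono nhdsWithin_le_nhds
      have e2 : ∀ᶠ y in nhdsWithin (-β) (Set.Ioi (-β)), y ∈ Set.Ioo (-β) β :=
        Ioo_mem_nhdsGT (by linarith)
      obtain ⟨y, hy1, hy2⟩ := (e1.and e2).exists
      exact ⟨y, hy1, abs_lt.mpr hy2⟩
    obtain ⟨ε, hε, hxε⟩ : ∃ ε, 0 < ε ∧ |x| + ε < β :=
      ⟨(β - |x|) / 2, by linarith, by linarith⟩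
    obtain ⟨δ, hδ, hyδ⟩ : ∃ δ, 0 < δ ∧ |y| + δ < β :=
      ⟨(β - |y|) / 2, by linarith, by linarith⟩
    refine ⟨m + 2, ((m + 2 : ℕ) : ℤ) / 2, _, _, _, _, ⟨_, rfl⟩,
      LinearMatch.admissible_leaderTeam (m + 1) hα h1 hε.le hxε,
      LinearMatch.admissible_leaderTeam (m + 1) hα h1 hδ.le hyδ,
      LinearMatch.mem_Ioo_meanScore_leaderTeam hα h1 hm1 hε.le hxε,
      LinearMatch.mem_Ioo_meanScore_leaderTeam hα h1 hm1 hδ.le hyδ, ?_⟩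
    rintro ⟨σ, hσ1, hσ2⟩
    exact hσ1.apply_zero_ne hα h1 hε hxε hx (hσ2.apply_zero_eq hα h1 hδ hyδ hy)
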